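/- **Corollary 4.1.** There are universal constants $a,b>0$ such that the following holds. Let $(\mathcal X,d)$ be a complete separable metric space, $\mu$ a Borel probability measure on $\mathcal X$ and $\alpha:[0,\infty)\to[0,\infty)$ a non-increasing function. For $n\ge 1$, $A\subseteq\mathcal X^n$ and $r\ge 0$ put $$d_2(x,y)=\Big(\sum_{i=1}^n d(x_i,y_i)^2\Big)^{1/2},\qquad A_{r,2}=\{x\in\mathcal X^n:\ d_2(x,A)\le r\}.$$ Say that $\mu$ satisfies $\mathbf{CI}_2^\infty(\alpha)$ if $$\mu^n(A_{r,2})\ \ge\ 1-\alpha(r)\qquad\text{for all } n\ge1,\ \text{all } r\ge 0\ \text{and all Borel } A\subseteq\mathcal X^n\ \text{with } \mu^n(A)\ge \tfrac12 .$$ Assume that $\mu$ satisfies $\mathbf{CI}_2^\infty(\alpha)$ and that $\alpha(r_o)<1/2$ for some $r_o\ge 0$. Let $\overline\Phi(x)=\frac1{\sqrt{2\pi}}\int_x^{\infty}e^{-u^2/2}\,du$, with inverse $\overline\Phi^{-1}$ and $\overline\Phi^{-1}(0)=+\infty$, and define $\lambda\in[0,+\infty]$ by $$\sqrt\lambda=\sup\left\{\frac{\overline\Phi^{-1}(\alpha(r))}{r}:\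 r>0,\ \alpha(r)<\tfrac12\right\}.$$ Then $\lambda>0$, and $\mu$ satisfies $\mathbf{CI}_2^\infty(\tilde\alpha)$ with the exponential profile $$\tilde\alpha(r)=b\,e^{-a\sqrt\lambda\, r},\qquad r\ge 0,$$ with the conventions $\infty\cdot 0=0$ and $e^{-\infty}=0$ when $\lambda=+\infty$. -/

import Mathlib

open MeasureTheory Set
open scoped NNReal ENNReal

noncomputable section

namespace DimFreeConc

/-- The `ℓ₂` enlargement `A_{r,2} = {x ∈ Xⁿ ; d₂(x, A) ≤ r}` of a subset `A` of `Xⁿ`, where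
`d₂(x, y) = (∑ᵢ d(xᵢ, yᵢ)²)^{1/2}` is the distance of `PiLp 2`. -/
def enlargement {X : Type*} [MetricSpace X] {n : ℕ} (A : Set (Fin n → X)) (r : ℝ≥0) :
    Set (Fin n → X) :=
  {x | Metric.infEDist (WithLp.toLp 2 x : PiLp 2 (fun _ : Fin n => X)) (WithLp.toLp 2 '' A)
    ≤ (r : ℝ≥0∞)}

/-- The dimension free concentration property of `μ` with profile `α`, with respect to the
`ℓ₂` product structure: `μⁿ(A_{r,2}) ≥ 1 - α(r)` for all `n ≥ 1`, all Borel `A ⊆ Xⁿ` with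
`μⁿ(A) ≥ 1/2`, and all `r ≥ 0`. -/
def DimFreeConcentration {X : Type*} [MetricSpace X] [MeasurableSpace X] (μ : Measure X)
    (α : ℝ≥0 → ℝ≥0) : Prop :=
  ∀ n : ℕ, 1 ≤ n → ∀ A : Set (Fin n → X), MeasurableSet A →
    1 / 2 ≤ (Measure.pi fun _ : Fin n => μ).real A →
    ∀ r : ℝ≥0, 1 - (α r : ℝ) ≤ (Measure.pi fun _ : Fin n => μ).real (enlargement A r)

/-- The tail distribution function of the standard Gaussian measure on `ℝ`. -/
def gaussianTail (x : ℝ) : ℝ :=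
  1 / Real.sqrt (2 * Real.pi) * ∫ u in Ioi x, Real.exp (-u ^ 2 / 2)

/-- The inverse of the (continuous, strictly decreasing) function `gaussianTail : ℝ → (0, 1)`,
extended by its limits; in particular its value at `0` is `+∞`. -/
def gaussianTailInv (t : ℝ) : EReal :=
  sSup ((fun x : ℝ => (x : EReal)) '' {x : ℝ | t ≤ gaussianTail x})

/-- The number `√λ ∈ [0, +∞]` attached to the profile `α`. -/
def sqrtLambda (α : ℝ≥0 → ℝ≥0) : EReal :=
  sSup {v : EReal | ∃ r : ℝ≥0, 0 < r ∧ (α r : ℝ) < 1 / 2 ∧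
    v = gaussianTailInv (α r) / ((r : ℝ) : EReal)}

/-- The profile `r ↦ b exp (-a s r)`, for `s ∈ [0, +∞]`, with the conventions `∞ * 0 = 0` and
`exp (-∞) = 0`. The exponent is never positive, so that the exponential is finite. -/
def expProfile (a b : ℝ≥0) (s : EReal) (r : ℝ≥0) : ℝ≥0 :=
  b * (EReal.exp (-(((a : ℝ) : EReal) * s * ((r : ℝ) : EReal)))).toNNReal

end DimFreeConc

end

/-!
Dimension free concentration yields exponential concentration in two independent steps.

*Variance.* Let `α(r) ≤ Φ̄(x)` and let `f` be a bounded `1`-Lipschitz function on `X` with mean `M`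
and variance `σ² > 0`. The normalised sums `S = n^{-1/2} ∑ (f(xᵢ) - M) / σ` are `σ⁻¹`-Lipschitz for
`d₂` on `Xⁿ`, so that concentration around `{S ≤ η}` shows that `S ≤ η + r / σ` with probability at
least `1 - α(r)`. By the central limit theorem, `Φ̄(η + r / σ) ≤ α(r) ≤ Φ̄(x)` for every `η > 0`,
that is `x σ ≤ r` (`DimFreeConcentration.mul_sqrt_variance_le`). Optimising over `r` and `x` gives
`Var f ≤ 1 / λ`. The hypothesis is inherited by the `ℓ₂` powers `X^m`
(`DimFreeConcentration.power`), so the bound holds on all of them, and a Chebyshev inequality for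
truncated distance functions gives `μⁿ(A_{h,2}) ≥ 49 / 50` for all `n`, with `h` of order `1 / √λ`
(`DimFreeConcentration.of_lt_sqrtLambda`).

*Amplification.* If `μ(Bᶜ) = δ ≤ 1 / 2`, then `Bⁿ` has measure at least `1 / 2` for `n` of order
`1 / δ`. The enlargement of `Bⁿ` lies in the power of the enlargement of `B`, which therefore misses
only a small fraction of `δ` (`one_sub_measureReal_infEDist_le`). Each further enlargement by `h`
thus divides the measure of the complement by `e` at least, whence the exponential profile.

All bounds are proved for real numbers `c < √λ`, which covers `√λ = +∞` as well.
-/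

open ProbabilityTheory Filter Topology

namespace DimFreeConc

/-! ### Powers of the space -/

lemma edist_piLp_two {ι : Type*} [Fintype ι] {X : Type*} [PseudoEMetricSpace X]
    (x y : PiLp 2 fun _ : ι => X) :
    edist x y = (∑ i, edist (x i) (y i) ^ (2 : ℝ)) ^ (1 / 2 : ℝ) := by
  rw [PiLp.edist_eq_sum (by norm_num)]
  norm_num

/-- The identification of `X^{nm}` with `(X^m)^n`, cutting a point into `n` blocks of `m`
coordinates. The inner power carries its `ℓ₂` distance, the outer one is a bare function type, as
in `DimFreeConcentration`. -/
def blockMap {X : Type*} (n m : ℕ) (x : Fin (n * m) → X) : Fin n → PiLp 2 (fun _ : Fin m => X) :=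
  fun i => WithLp.toLp 2 fun j => x (finProdFinEquiv (i, j))

lemma isometry_blockMap {X : Type*} [MetricSpace X] (n m : ℕ) :
    Isometry fun x : PiLp 2 (fun _ : Fin (n * m) => X) =>
      (WithLp.toLp 2 (blockMap n m x.ofLp) :
        PiLp 2 (fun _ : Fin n => PiLp 2 (fun _ : Fin m => X))) := by
  intro x y
  simp only [edist_piLp_two]
  congr 1
  rw [← finProdFinEquiv.sum_comp, Fintype.sum_prod_type]
  refine Finset.sum_congr rfl fun i _ => ?_
  rw [← ENNReal.rpow_mul]
  simp [blockMap]

lemma blockMap_surjective {X : Type*} (n m : ℕ) : Function.Surjective (blockMap (X := X) n m) := by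
  intro y
  refine ⟨fun k => y (finProdFinEquiv.symm k).1 (finProdFinEquiv.symm k).2, ?_⟩
  ext i j
  simp [blockMap]

lemma measurePreserving_blockMap {X : Type*} [MeasurableSpace X] (μ : Measure X)
    [IsProbabilityMeasure μ] (n m : ℕ) :
    MeasurePreserving (blockMap n m) (Measure.pi fun _ : Fin (n * m) => μ)
      (Measure.pi fun _ : Fin n => (Measure.pi fun _ : Fin m => μ).map (WithLp.toLp 2)) := by
  have hmeas : Measurable (blockMap (X := X) n m) := by
    unfold blockMap
    fun_prop
  refine ⟨hmeas, ?_⟩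
  have : IsProbabilityMeasure ((Measure.pi fun _ : Fin m => μ).map (WithLp.toLp 2)) :=
    Measure.isProbabilityMeasure_map (by fun_prop)
  rw [← Measure.infinitePi_eq_pi, ← Measure.infinitePi_eq_pi, ← Measure.infinitePi_eq_pi,
    ← Measure.infinitePi_map_pi (μ := fun _ : Fin n => Measure.infinitePi fun _ : Fin m => μ)
      (f := fun _ => WithLp.toLp 2) (fun _ => by fun_prop),
    ← Measure.infinitePi_map_curry (fun (_ : Fin n) (_ : Fin m) => μ),
    ← Measure.infinitePi_map_piCongrLeft (fun _ : Fin n × Fin m => μ) finProdFinEquiv.symm,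
    Measure.map_map (by fun_prop) (by fun_prop), Measure.map_map (by fun_prop) (by fun_prop)]
  congr 1
  ext x i j
  simp [blockMap, MeasurableEquiv.piCongrLeft, Equiv.piCongrLeft, MeasurableEquiv.curry]

/-- Dimension free concentration is inherited, with the same profile, by the `ℓ₂` powers of the
space: an enlargement in `(X^m)^n` is one in `X^{nm}`. -/
lemma DimFreeConcentration.power {X : Type*} [MetricSpace X] [MeasurableSpace X] {μ : Measure X}
    [IsProbabilityMeasure μ] {α : ℝ≥0 → ℝ≥0} (h : DimFreeConcentration μ α) {m : ℕ} (hm : 1 ≤ m) :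
    DimFreeConcentration (X := PiLp 2 fun _ : Fin m => X)
      ((Measure.pi fun _ : Fin m => μ).map (WithLp.toLp 2)) α := by
  have : IsProbabilityMeasure ((Measure.pi fun _ : Fin m => μ).map (WithLp.toLp 2)) :=
    Measure.isProbabilityMeasure_map (by fun_prop)
  intro n hn B hB hB2 r
  have hp := measurePreserving_blockMap μ n m
  have h1 := h (n * m) (Nat.mul_pos hn hm) (blockMap n m ⁻¹' B) (hp.measurable hB)
    (by rwa [hp.measureReal_preimage hB.nullMeasurableSet]) r
  refine h1.trans ?_
  have hsub : enlargement (blockMap n m ⁻¹' B) r ⊆ blockMap n m ⁻¹' enlargement B r := by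
    intro x hx
    have himg : WithLp.toLp 2 '' B =
        (fun x : PiLp 2 (fun _ : Fin (n * m) => X) =>
          (WithLp.toLp 2 (blockMap n m x.ofLp) :
            PiLp 2 (fun _ : Fin n => PiLp 2 (fun _ : Fin m => X)))) ''
          (WithLp.toLp 2 '' (blockMap n m ⁻¹' B)) := by
      conv_lhs => rw [← image_preimage_eq B (blockMap_surjective n m)]
      rw [image_image, image_image]
    simp only [enlargement, mem_preimage, mem_ofPred_eq] at hx ⊢
    rw [himg]
    exact (Metric.infEDist_image (isometry_blockMap n m)).trans_le hx
  refine ENNReal.toReal_mono (measure_ne_top _ _) ((measure_mono hsub).trans ?_)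
  rw [← hp.map_eq]
  exact Measure.le_map_apply hp.aemeasurable _

lemma measureReal_map_toLp {ι X : Type*} [MeasurableSpace X] (P : Measure (ι → X))
    (S : Set (PiLp 2 fun _ : ι => X)) :
    (P.map (WithLp.toLp 2)).real S = P.real (WithLp.toLp 2 ⁻¹' S) :=
  congrArg ENNReal.toReal ((MeasurableEquiv.toLp 2 (ι → X)).map_apply S)

/-! ### Gaussian tails -/

lemma gaussianTail_eq (x : ℝ) : gaussianTail x = (gaussianReal 0 1).real (Ioi x) := by
  rw [Measure.real, gaussianReal_apply_eq_integral _ one_ne_zero,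
    ENNReal.toReal_ofReal (integral_nonneg fun _ => gaussianPDFReal_nonneg _ _ _), gaussianTail,
    ← integral_const_mul]
  simp [gaussianPDFReal]

lemma gaussianReal_real_Iic (x : ℝ) : (gaussianReal 0 1).real (Iic x) = 1 - gaussianTail x := by
  rw [gaussianTail_eq, ← compl_Iic, probReal_compl_eq_one_sub measurableSet_Iic]
  ring

lemma strictAnti_gaussianTail : StrictAnti gaussianTail := by
  intro x y hxy
  have h1 : (gaussianReal 0 1).real (Ioi x) =
      (gaussianReal 0 1).real (Ioc x y) + (gaussianReal 0 1).real (Ioi y) := by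
    have hd : Disjoint (Ioc x y) (Ioi y) :=
      Set.disjoint_left.2 fun a ha hb => absurd ha.2 (not_le.2 hb)
    rw [← measureReal_union hd measurableSet_Ioi, Ioc_union_Ioi_eq_Ioi hxy.le]
  have h2 : 0 < (gaussianReal 0 1).real (Ioc x y) := by
    refine ENNReal.toReal_pos (fun h0 => ?_) (measure_ne_top _ _)
    have := gaussianReal_absolutelyContinuous' 0 (one_ne_zero) h0
    simp only [Real.volume_Ioc, ENNReal.ofReal_eq_zero, sub_nonpos] at this
    exact absurd hxy (not_lt.2 this)
  rw [gaussianTail_eq, gaussianTail_eq]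
  linarith

lemma gaussianTail_zero : gaussianTail 0 = 1 / 2 := by
  have h1 : (gaussianReal 0 1).real (Ioi 0) = (gaussianReal 0 1).real (Iio 0) := by
    conv_lhs =>
      rw [← neg_zero, ← gaussianReal_map_neg,
        map_measureReal_apply (by fun_prop) measurableSet_Ioi]
    congr 1
    ext; simp
  have : NullSingletonClass (gaussianReal 0 1) := nullSingletonClass_gaussianReal one_ne_zero
  have h2 : (gaussianReal 0 1).real (Iio 0) = (gaussianReal 0 1).real (Iic 0) :=
    measureReal_congr Iio_ae_eq_Iic
  have h3 := gaussianReal_real_Iic 0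
  rw [← h2, ← h1, ← gaussianTail_eq] at h3
  linarith

lemma exists_pos_le_gaussianTail {t : ℝ} (ht : t < 1 / 2) : ∃ x > 0, t ≤ gaussianTail x := by
  by_contra! hcon
  have hlim : Tendsto (fun n : ℕ => (gaussianReal 0 1).real (Ioi (1 / (n + 1) : ℝ))) atTop
      (𝓝 ((gaussianReal 0 1).real (⋃ n : ℕ, Ioi (1 / (n + 1) : ℝ)))) := by
    refine (ENNReal.tendsto_toReal (measure_ne_top _ _)).comp (tendsto_measure_iUnion_atTop ?_)
    intro a b hab
    exact Ioi_subset_Ioi (Nat.one_div_le_one_div hab)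
  have hU : (⋃ n : ℕ, Ioi (1 / (n + 1) : ℝ)) = Ioi 0 := by
    ext x
    simp only [mem_iUnion, mem_Ioi]
    exact ⟨fun ⟨n, hn⟩ => lt_trans (by positivity) hn, fun hx => exists_nat_one_div_lt hx⟩
  rw [hU, ← gaussianTail_eq, gaussianTail_zero] at hlim
  refine absurd (le_of_tendsto' hlim fun n => ?_) (not_le.2 ht)
  rw [← gaussianTail_eq]
  exact (hcon _ (by positivity)).le

/-! ### The variance of Lipschitz functions -/

/-- A `K`-Lipschitz function that is at most `t` on `S` is at most `t + K r` at distance `r`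
of `S`. -/
lemma le_add_of_infEDist_le {Y : Type*} [PseudoEMetricSpace Y] {K : ℝ≥0} {F : Y → ℝ}
    (hF : LipschitzWith K F) {S : Set Y} {t : ℝ} (hS : ∀ y ∈ S, F y ≤ t) {x : Y} {r : ℝ≥0}
    (hx : Metric.infEDist x S ≤ r) : F x ≤ t + K * r := by
  have key : ∀ s : ℝ≥0, r < s → F x ≤ t + K * s := by
    intro s hs
    obtain ⟨y, hy, hxy⟩ := Metric.infEDist_lt_iff.1 (hx.trans_lt (ENNReal.coe_lt_coe.2 hs))
    have h1 : edist (F x) (F y) ≤ ((K * s : ℝ≥0) : ℝ≥0∞) := by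
      rw [ENNReal.coe_mul]
      exact (hF x y).trans (by gcongr)
    rw [edist_nndist, ENNReal.coe_le_coe] at h1
    have h2 : dist (F x) (F y) ≤ K * s := by exact_mod_cast h1
    have h3 := (le_abs_self _).trans ((Real.dist_eq _ _).symm.trans_le h2)
    linarith [hS y hy]
  have hlim : Tendsto (fun s : ℝ≥0 => t + K * (s : ℝ)) (𝓝[>] r) (𝓝 (t + K * r)) :=
    (Continuous.tendsto (by fun_prop) r).mono_left nhdsWithin_le_nhds
  exact ge_of_tendsto hlim (eventually_nhdsWithin_of_forall fun s hs => key s hs)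

lemma lipschitzWith_normalized_sum {X : Type*} [MetricSpace X] {g : X → ℝ} {K : ℝ≥0}
    (hg : LipschitzWith K g) (n : ℕ) :
    LipschitzWith K fun x : PiLp 2 (fun _ : Fin n => X) => (√n)⁻¹ * ∑ k, g (x k) := by
  refine LipschitzWith.of_dist_le_mul fun x y => ?_
  have hd : dist x y = √(∑ i, dist (x i) (y i) ^ 2) := by
    rw [PiLp.dist_eq_sum (by norm_num), Real.sqrt_eq_rpow]
    norm_num
  rw [hd, Real.dist_eq, ← mul_sub, ← Finset.sum_sub_distrib, abs_mul, abs_of_nonneg (by positivity)]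
  have h1 : |∑ k, (g (x k) - g (y k))| ≤ K * ∑ k, dist (x k) (y k) := by
    rw [Finset.mul_sum]
    refine (Finset.abs_sum_le_sum_abs _ _).trans (Finset.sum_le_sum fun k _ => ?_)
    rw [← Real.dist_eq]
    exact hg.dist_le_mul _ _
  have h2 : ∑ k, dist (x k) (y k) ≤ √n * √(∑ i, dist (x i) (y i) ^ 2) := by
    rw [← Real.sqrt_mul (Nat.cast_nonneg n)]
    refine Real.le_sqrt_of_sq_le ?_
    simpa using sq_sum_le_card_mul_sum_sq (s := Finset.univ) (f := fun k => dist (x k) (y k))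
  rcases Nat.eq_zero_or_pos n with rfl | hn
  · simp
  have hn' : 0 < √(n : ℝ) := Real.sqrt_pos.2 (Nat.cast_pos.2 hn)
  calc (√n)⁻¹ * |∑ k, (g (x k) - g (y k))|
      ≤ (√n)⁻¹ * (K * (√n * √(∑ i, dist (x i) (y i) ^ 2))) := by gcongr; exact h1.trans (by gcongr)
    _ = K * √(∑ i, dist (x i) (y i) ^ 2) := by field_simp

/-- The central limit theorem for the distribution functions of the normalised sums of a function
of the coordinates on the finite powers of a probability space. -/
lemma tendsto_measureReal_normalized_sum_le {X : Type*} [MeasurableSpace X] (μ : Measure X)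
    [IsProbabilityMeasure μ] {g : X → ℝ} (hg : Measurable g) (h0 : ∫ x, g x ∂μ = 0)
    (h1 : ∫ x, g x ^ 2 ∂μ = 1) (t : ℝ) :
    Tendsto (fun n : ℕ => (Measure.pi fun _ : Fin n => μ).real
      {x | (√n)⁻¹ * ∑ k, g (x k) ≤ t}) atTop (𝓝 (1 - gaussianTail t)) := by
  set P := Measure.infinitePi fun _ : ℕ => μ
  have hev (k : ℕ) : MeasurePreserving (Function.eval k) P μ :=
    measurePreserving_eval_infinitePi (fun _ : ℕ => μ) k
  have hgk (k : ℕ) : Measurable fun ω : ℕ → X => g (ω k) := hg.comp (hev k).measurable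
  have hind : iIndepFun (fun (k : ℕ) (ω : ℕ → X) => g (ω k)) P :=
    iIndepFun_infinitePi (X := fun _ => g) fun _ => hg
  have hclt : TendstoInDistribution
      (fun (n : ℕ) (ω : ℕ → X) => (√n)⁻¹ * ∑ k ∈ Finset.range n, g (ω k)) atTop (id : ℝ → ℝ)
      (fun _ => P) (gaussianReal 0 1) := by
    refine tendstoInDistribution_inv_sqrt_mul_sum (X := fun k (ω : ℕ → X) => g (ω k))
      HasLaw.id ?_ ?_ hind
      fun k => ⟨(hgk k).aemeasurable, (hgk 0).aemeasurable, ?_⟩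
    · rw [← h0]
      exact ((hev 0).hasLaw.integral_comp hg.aestronglyMeasurable)
    · rw [← h1]
      exact ((hev 0).hasLaw.integral_comp (hg.pow_const 2).aestronglyMeasurable)
    · have (k : ℕ) : P.map (fun ω => g (ω k)) = μ.map g := by
        rw [← (hev k).map_eq, Measure.map_map hg (hev k).measurable]
        rfl
      rw [this, this]
  have : NullSingletonClass (gaussianReal 0 1) := nullSingletonClass_gaussianReal one_ne_zero
  have hlim := ProbabilityMeasure.tendsto_measure_of_null_frontier_of_tendsto' hclt.tendsto
    (E := Iic t) (by simp)
  have hlim' := (ENNReal.tendsto_toReal (by simp)).comp hlim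
  simp only [ProbabilityMeasure.coe_mk, Measure.map_id] at hlim'
  rw [← gaussianReal_real_Iic]
  refine hlim'.congr fun n => ?_
  -- The first `n` coordinates of an infinite product are distributed as the finite product.
  have hrestr : P.map (fun (ω : ℕ → X) (i : Fin n) => ω i) = Measure.pi fun _ : Fin n => μ := by
    have hi := (iIndepFun_infinitePi (P := fun _ : ℕ => μ) (X := fun _ => id)
      fun _ => measurable_id).precomp (Fin.val_injective (n := n))
    refine ((iIndepFun_iff_map_fun_eq_pi_map fun i : Fin n =>
      (measurable_pi_apply (i : ℕ)).aemeasurable).1 hi).trans ?_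
    congr 1
    ext1 i
    exact (hev i).map_eq
  have hm : Measurable fun x : Fin n → X => (√n)⁻¹ * ∑ k, g (x k) := by fun_prop
  have hs : MeasurableSet {x : Fin n → X | (√n)⁻¹ * ∑ k, g (x k) ≤ t} := hm measurableSet_Iic
  rw [← hrestr, map_measureReal_apply (by fun_prop) hs, Function.comp_apply,
    Measure.map_apply (by fun_prop) measurableSet_Iic, Measure.real]
  congr 2
  ext ω
  simp [Finset.sum_range]

/-- Under dimension free concentration, the variance of a bounded `1`-Lipschitz function `f` is
controlled by any single value of the profile: the concentration of the normalised sums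
`n^{-1/2} ∑ f(xᵢ)` on `Xⁿ` passes to the limit in the central limit theorem. -/
lemma DimFreeConcentration.mul_sqrt_variance_le {X : Type*} [MetricSpace X] [MeasurableSpace X]
    [BorelSpace X] {μ : Measure X} [IsProbabilityMeasure μ] {α : ℝ≥0 → ℝ≥0}
    (h : DimFreeConcentration μ α) {f : X → ℝ} (hf : LipschitzWith 1 f) {C : ℝ}
    (hC : ∀ x, |f x| ≤ C) {r : ℝ≥0} {x : ℝ} (hx : (α r : ℝ) ≤ gaussianTail x) :
    x * √Var[f; μ] ≤ r := by
  rcases eq_or_ne Var[f; μ] 0 with h0 | h0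
  · simp [h0]
  have hvar : 0 < Var[f; μ] := lt_of_le_of_ne (variance_nonneg _ _) h0.symm
  set σ := √Var[f; μ] with hσdef
  have hσ : 0 < σ := Real.sqrt_pos.2 hvar
  have hfm : Measurable f := hf.continuous.measurable
  have hfi : Integrable f μ := Integrable.of_bound hfm.aestronglyMeasurable C (ae_of_all _ hC)
  set M := ∫ y, f y ∂μ with hM
  let g : X → ℝ := fun y => (f y - M) / σ
  have hgm : Measurable g := by fun_prop
  have hg0 : ∫ y, g y ∂μ = 0 := by
    simp only [g]
    rw [integral_div, integral_sub hfi (integrable_const _)]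
    simp [hM]
  have hg1 : ∫ y, g y ^ 2 ∂μ = 1 := by
    simp only [g, div_pow]
    rw [integral_div, ← variance_eq_integral hfm.aemeasurable, Real.sq_sqrt hvar.le, div_self h0]
  have hgL : LipschitzWith (Real.toNNReal σ⁻¹) g := by
    refine LipschitzWith.of_dist_le_mul fun y z => ?_
    rw [Real.coe_toNNReal _ (by positivity), Real.dist_eq]
    have := hf.dist_le_mul y z
    rw [Real.dist_eq, NNReal.coe_one, one_mul] at this
    have hgg : g y - g z = σ⁻¹ * (f y - f z) := by simp only [g]; ring
    rw [hgg, abs_mul, abs_of_nonneg (by positivity)]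
    gcongr
  have hσK : (Real.toNNReal σ⁻¹ : ℝ) = σ⁻¹ := Real.coe_toNNReal _ (by positivity)
  -- The sublevel set `{S ≤ η}` is only known to have measure at least `1 / 2` for `η > 0`, in
  -- high dimension: the measure of `{S ≤ 0}` may lie below its limit `1 / 2`.
  have key : ∀ η > 0, x ≤ η + σ⁻¹ * r := by
    intro η hη
    have hmed : 1 / 2 < 1 - gaussianTail η := by
      have := strictAnti_gaussianTail hη
      rw [gaussianTail_zero] at this
      linarith
    have hlow := tendsto_measureReal_normalized_sum_le μ hgm hg0 hg1 η
    have hup := tendsto_measureReal_normalized_sum_le μ hgm hg0 hg1 (η + σ⁻¹ * r)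
    have hev : ∀ᶠ n : ℕ in atTop, 1 - (α r : ℝ) ≤ (Measure.pi fun _ : Fin n => μ).real
        {z | (√n)⁻¹ * ∑ k, g (z k) ≤ η + σ⁻¹ * r} := by
      filter_upwards [hlow.eventually_const_lt hmed, eventually_ge_atTop 1] with n hn hn1
      have hm : Measurable fun z : Fin n → X => (√n)⁻¹ * ∑ k, g (z k) := by fun_prop
      refine (h n hn1 _ (hm measurableSet_Iic) hn.le r).trans (measureReal_mono ?_)
      intro z hz
      have := le_add_of_infEDist_le (lipschitzWith_normalized_sum hgL n) (t := η) ?_ hz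
      · rwa [hσK] at this
      · rintro _ ⟨w, hw, rfl⟩
        exact hw
    have hle := ge_of_tendsto hup hev
    exact strictAnti_gaussianTail.le_iff_ge.1 (by linarith)
  have hle : x ≤ σ⁻¹ * r := le_of_forall_pos_le_add fun η hη => by linarith [key η hη]
  rwa [inv_mul_eq_div, le_div_iff₀ hσ] at hle

/-! ### From a variance bound to concentration at one scale -/

/-- A Chebyshev type inequality. The function `f = min (d(·, A), h)` vanishes on `A` and equals `h`
at distance more than `h`; as `A` has at least the measure of that far set `E`, whatever its mean
is, `f` has variance at least `ν(E) h² / 2`. -/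
lemma measureReal_lt_infEDist_le {Y : Type*} [MetricSpace Y] [MeasurableSpace Y] [BorelSpace Y]
    {ν : Measure Y} [IsProbabilityMeasure ν] {V : ℝ} {h : ℝ≥0}
    (hV : ∀ f : Y → ℝ, LipschitzWith 1 f → (∀ y, |f y| ≤ h) → Var[f; ν] ≤ V)
    {A : Set Y} (hA : MeasurableSet A) (hA2 : 1 / 2 ≤ ν.real A) :
    ν.real {y | (h : ℝ≥0∞) < Metric.infEDist y A} * h ^ 2 ≤ 2 * V := by
  have hne : A.Nonempty := by
    by_contra hcon
    rw [not_nonempty_iff_eq_empty] at hcon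
    norm_num [hcon] at hA2
  let f : Y → ℝ := fun y => min (Metric.infDist y A) h
  have hfL : LipschitzWith 1 f := (Metric.lipschitz_infDist_pt A).min_const _
  have hfb : ∀ y, |f y| ≤ h := fun y => by
    change |min (Metric.infDist y A) (h : ℝ)| ≤ h
    rw [abs_of_nonneg (le_min Metric.infDist_nonneg h.coe_nonneg)]
    exact min_le_right _ _
  have hfm : Measurable f := hfL.continuous.measurable
  set E := {y | (h : ℝ≥0∞) < Metric.infEDist y A}
  have hE : MeasurableSet E := measurableSet_lt measurable_const measurable_infEDist
  have hfA : ∀ y ∈ A, f y = 0 := fun y hy => by simp [f, Metric.infDist_zero_of_mem hy]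
  have hfE : ∀ y ∈ E, f y = h := fun y hy => by
    refine min_eq_right ?_
    rw [Metric.infDist, ← ENNReal.coe_toReal h]
    exact ENNReal.toReal_mono (Metric.infEDist_ne_top hne) (le_of_lt hy)
  have hEA : Disjoint A E := Set.disjoint_left.2 fun y hy hyE => by
    simp [E, Metric.infEDist_zero_of_mem hy] at hyE
  set M := ∫ y, f y ∂ν
  have hlow : ν.real A * M ^ 2 + ν.real E * (h - M) ^ 2 ≤ Var[f; ν] := by
    rw [variance_eq_integral hfm.aemeasurable]
    calc ν.real A * M ^ 2 + ν.real E * (h - M) ^ 2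
        = ∫ y, A.indicator (fun _ => M ^ 2) y + E.indicator (fun _ => (h - M) ^ 2) y ∂ν := by
          rw [integral_add ((integrable_const _).indicator hA) ((integrable_const _).indicator hE),
            integral_indicator_const _ hA, integral_indicator_const _ hE, smul_eq_mul, smul_eq_mul]
      _ ≤ ∫ y, (f y - M) ^ 2 ∂ν := by
          refine integral_mono (((integrable_const _).indicator hA).add
            ((integrable_const _).indicator hE)) ?_ fun y => ?_
          · refine Integrable.of_bound (by fun_prop) ((h + |M|) ^ 2) (ae_of_all _ fun y => ?_)
            rw [Real.norm_eq_abs, abs_pow]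
            gcongr
            exact (abs_sub _ _).trans (by gcongr; exact hfb y)
          · by_cases hyA : y ∈ A
            · simp [hyA, Set.disjoint_left.1 hEA hyA, hfA y hyA]
            · by_cases hyE : y ∈ E
              · simp [hyA, hyE, hfE y hyE]
              · simp [hyA, hyE, sq_nonneg]
  have hsum : ν.real A + ν.real E ≤ 1 := by
    rw [← measureReal_union hEA hE]
    exact measureReal_le_one
  -- Since `ν E ≤ ν A`, the left side of `hlow` is at least
  -- `ν E * (M² + (h - M)²) ≥ ν E * h² / 2`.
  have hE0 : 0 ≤ ν.real E := measureReal_nonneg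
  have hVf := hV f hfL hfb
  nlinarith [sq_nonneg (h - 2 * M : ℝ), mul_nonneg hE0 (sq_nonneg (h - 2 * M : ℝ)),
    mul_nonneg (sub_nonneg.2 (show ν.real E ≤ ν.real A by linarith)) (sq_nonneg M)]

/-- For `0 < c < √λ`, the variance of bounded `1`-Lipschitz functions is at most `1 / c²`. -/
lemma DimFreeConcentration.mul_sqrt_variance_le_one {X : Type*} [MetricSpace X]
    [MeasurableSpace X] [BorelSpace X] {μ : Measure X} [IsProbabilityMeasure μ] {α : ℝ≥0 → ℝ≥0}
    (hμ : DimFreeConcentration μ α) {c : ℝ} (hc : (c : EReal) < sqrtLambda α)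
    {f : X → ℝ} (hf : LipschitzWith 1 f) {C : ℝ} (hC : ∀ x, |f x| ≤ C) :
    c * √Var[f; μ] ≤ 1 := by
  obtain ⟨_, ⟨r, hr, -, rfl⟩, hcr⟩ := lt_sSup_iff.1 hc
  rw [EReal.lt_div_iff (by exact_mod_cast hr) (EReal.coe_ne_top _), gaussianTailInv,
    lt_sSup_iff] at hcr
  obtain ⟨_, ⟨x, hx, rfl⟩, hlt⟩ := hcr
  have hlt' : c * r < x := EReal.coe_lt_coe_iff.1 (by rw [EReal.coe_mul]; exact hlt)
  have h1 := hμ.mul_sqrt_variance_le hf hC hx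
  have hr' : (0 : ℝ) < r := hr
  have h2 : c * r * √Var[f; μ] ≤ x * √Var[f; μ] := by gcongr
  nlinarith

/-- For `c < √λ`, the complement of the enlargement at distance `10 / c` has measure at most
`2 / 10² = 1 / 50` in every dimension. The profile equals `1`, hence says nothing, below that
distance. -/
lemma DimFreeConcentration.of_lt_sqrtLambda {X : Type*} [MetricSpace X]
    [SecondCountableTopology X] [MeasurableSpace X] [BorelSpace X] {μ : Measure X}
    [IsProbabilityMeasure μ] {α : ℝ≥0 → ℝ≥0} (hμ : DimFreeConcentration μ α) {c h : ℝ≥0}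
    (hc : ((c : ℝ) : EReal) < sqrtLambda α) (hch : c * h = 10) :
    DimFreeConcentration μ (fun r => if h ≤ r then 1 / 50 else 1) := by
  intro n hn A hA hA2 r
  beta_reduce
  split_ifs with hr
  swap
  · simp
  have hc0 : 0 < (c : ℝ) := by
    refine lt_of_le_of_ne c.2 fun h0 => ?_
    rw [← NNReal.coe_zero, NNReal.coe_inj] at h0
    simp [← h0] at hch
  set ν := (Measure.pi fun _ : Fin n => μ).map (WithLp.toLp 2)
  have : IsProbabilityMeasure ν := Measure.isProbabilityMeasure_map (by fun_prop)
  have hAe : MeasurableSet (WithLp.toLp 2 '' A : Set (PiLp 2 fun _ : Fin n => X)) :=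
    (MeasurableEquiv.toLp 2 (Fin n → X)).measurableSet_image.2 hA
  have hcheb := measureReal_lt_infEDist_le (ν := ν) (V := (c : ℝ)⁻¹ ^ 2) (h := h) ?_ hAe ?_
  · have hS : MeasurableSet {y : PiLp 2 (fun _ : Fin n => X) |
        (h : ℝ≥0∞) < Metric.infEDist y (WithLp.toLp 2 '' A)} :=
      measurableSet_lt measurable_const measurable_infEDist
    have hcompl := probReal_compl_eq_one_sub (μ := ν) hS
    have hmono : ν.real {y | (h : ℝ≥0∞) < Metric.infEDist y (WithLp.toLp 2 '' A)}ᶜ ≤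
        (Measure.pi fun _ : Fin n => μ).real (enlargement A r) := by
      rw [measureReal_map_toLp]
      refine measureReal_mono fun x hx => ?_
      rw [mem_preimage, mem_compl_iff, mem_ofPred_eq, not_lt] at hx
      exact hx.trans (ENNReal.coe_le_coe.2 hr)
    have hh : (h : ℝ) = 10 * (c : ℝ)⁻¹ := by
      rw [← div_eq_mul_inv, eq_div_iff hc0.ne', mul_comm]
      exact_mod_cast hch
    have h3 : ν.real {y | (h : ℝ≥0∞) < Metric.infEDist y (WithLp.toLp 2 '' A)} ≤ 1 / 50 := by
      rw [hh] at hcheb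
      have : 0 < (c : ℝ)⁻¹ ^ 2 := by positivity
      nlinarith
    push_cast
    linarith
  · intro f hf hfb
    have h1 := (hμ.power hn).mul_sqrt_variance_le_one hc hf hfb
    rw [← Real.sq_sqrt (variance_nonneg f ν)]
    refine pow_le_pow_left₀ (Real.sqrt_nonneg _) ?_ 2
    rwa [← one_div, le_div_iff₀ hc0, mul_comm]
  · rw [measureReal_map_toLp, preimage_image_eq _ (WithLp.toLp_injective 2)]
    exact hA2

/-! ### From one scale to exponential decay -/

lemma enlargement_pi_subset {X : Type*} [MetricSpace X] (n : ℕ) (B : Set X) (h : ℝ≥0) :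
    enlargement (univ.pi fun _ : Fin n => B) h ⊆
      univ.pi fun _ : Fin n => {x | Metric.infEDist x B ≤ h} := by
  intro x hx i _
  refine le_trans ?_ (show Metric.infEDist _ _ ≤ _ from hx)
  refine Metric.le_infEDist.2 ?_
  rintro _ ⟨y, hy, rfl⟩
  exact (Metric.infEDist_le_edist_of_mem (hy i (mem_univ i))).trans
    (PiLp.edist_apply_le (WithLp.toLp 2 x : PiLp 2 (fun _ : Fin n => X)) (WithLp.toLp 2 y) i)

/-- Enlarging `B` by `h` divides the measure of its complement by a constant. If `Bᶜ` has measure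
`δ ≤ 1 / 2`, then `Bⁿ` has measure at least `1 / 2` for `n = ⌊1 / (2δ)⌋`. By concentration on `Xⁿ`,
the `n`-th power of the enlargement of `B` has measure at least `49 / 50`, which forces the
enlargement to miss a mass of at most `1 / (49 n)`. -/
lemma one_sub_measureReal_infEDist_le {X : Type*} [MetricSpace X] [MeasurableSpace X]
    {μ : Measure X} [IsProbabilityMeasure μ] {h : ℝ≥0}
    (hμ : DimFreeConcentration μ (fun r => if h ≤ r then 1 / 50 else 1))
    {B : Set X} (hB : MeasurableSet B) (hB2 : 1 / 2 ≤ μ.real B) :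
    1 - μ.real {x | Metric.infEDist x B ≤ h} ≤ 4 / 49 * (1 - μ.real B) := by
  set β := μ.real B
  set γ := μ.real {x | Metric.infEDist x B ≤ h}
  have hβ1 : β ≤ 1 := measureReal_le_one
  have hβγ : β ≤ γ := measureReal_mono fun x hx => by
    simp [Metric.infEDist_zero_of_mem hx]
  have hγ1 : γ ≤ 1 := measureReal_le_one
  rcases hβ1.eq_or_lt with h1 | h1
  · linarith
  have hδ : 0 < 1 - β := by linarith
  set n := ⌊1 / (2 * (1 - β))⌋₊
  have hx1 : 1 ≤ 1 / (2 * (1 - β)) := by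
    rw [le_div_iff₀ (by linarith)]
    linarith
  have hn1 : 1 ≤ n := Nat.le_floor (by simpa using hx1)
  -- By Bernoulli's inequality, `n δ ≤ 1 / 2` ensures `(1 - δ) ^ n ≥ 1 / 2`.
  have hnle : n * (1 - β) ≤ 1 / 2 := by
    have := Nat.floor_le (zero_le_one.trans hx1)
    rw [le_div_iff₀ (by linarith)] at this
    linarith
  -- The integer part loses at most a factor `2`, as `1 / (2δ) ≥ 1`.
  have hnge : 1 / 4 ≤ n * (1 - β) := by
    have hlt := Nat.lt_floor_add_one (1 / (2 * (1 - β)))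
    rw [div_lt_iff₀ (by linarith)] at hlt
    have hn1' : (1 : ℝ) ≤ n := by exact_mod_cast hn1
    nlinarith
  have hpi (S : Set X) : (Measure.pi fun _ : Fin n => μ).real (univ.pi fun _ => S) =
      μ.real S ^ n := by
    simp [Measure.real, Measure.pi_pi]
  have hconc := hμ n hn1 (univ.pi fun _ => B) (MeasurableSet.univ_pi fun _ => hB) (by
    rw [hpi]
    have := one_add_mul_le_pow (a := β - 1) (by linarith) n
    rw [add_sub_cancel] at this
    linarith) h
  have hγn : 49 / 50 ≤ γ ^ n := by
    rw [← hpi]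
    refine le_trans ?_ (hconc.trans (measureReal_mono (enlargement_pi_subset n B h)))
    simp only [le_refl, if_true]
    norm_num
  -- Bernoulli's inequality for `2 - γ`, with `γ (2 - γ) ≤ 1`, bounds `γ ^ n` from above.
  have hprod : γ ^ n * (1 + n * (1 - γ)) ≤ 1 := by
    calc γ ^ n * (1 + n * (1 - γ)) ≤ γ ^ n * (1 + (1 - γ)) ^ n := by
          have := one_add_mul_le_pow (a := 1 - γ) (by linarith) n
          gcongr
      _ = (γ * (2 - γ)) ^ n := by rw [← mul_pow]; ring_nf
      _ ≤ 1 := pow_le_one₀ (mul_nonneg (by linarith) (by linarith)) (by nlinarith)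
  have hn0 : (0 : ℝ) < n := by exact_mod_cast hn1
  have hnγ : n * (1 - γ) ≤ 1 / 49 := by
    have : 0 ≤ n * (1 - γ) := mul_nonneg hn0.le (by linarith)
    nlinarith
  have : n * (1 - γ) ≤ n * (4 / 49 * (1 - β)) := by linarith
  exact le_of_mul_le_mul_left this hn0

/-- The iteration of the previous lemma, with the factor `4 / 49` relaxed to `e⁻¹`. -/
lemma one_sub_exp_le_measureReal {X : Type*} [MetricSpace X] [MeasurableSpace X] [BorelSpace X]
    {μ : Measure X} [IsProbabilityMeasure μ] {h : ℝ≥0}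
    (hμ : DimFreeConcentration μ (fun r => if h ≤ r then 1 / 50 else 1))
    {A : Set X} (hA2 : 1 / 2 ≤ μ.real A) (k : ℕ) :
    1 - Real.exp (-k) / 2 ≤ μ.real {x | Metric.infEDist x A ≤ ((k * h : ℝ≥0) : ℝ≥0∞)} := by
  induction k with
  | zero =>
    have : μ.real A ≤ μ.real {x | Metric.infEDist x A ≤ (((0 : ℕ) * h : ℝ≥0) : ℝ≥0∞)} :=
      measureReal_mono fun x hx => by simp [Metric.infEDist_zero_of_mem hx]
    norm_num at this ⊢
    linarith
  | succ k ih =>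
    set B := {x | Metric.infEDist x A ≤ ((k * h : ℝ≥0) : ℝ≥0∞)}
    have hB : MeasurableSet B := measurableSet_le measurable_infEDist measurable_const
    have hk : Real.exp (-k) ≤ 1 := Real.exp_le_one_iff.2 (by simp)
    have hstep := one_sub_measureReal_infEDist_le hμ hB (by linarith)
    have hsub : {x | Metric.infEDist x B ≤ h} ⊆
        {x | Metric.infEDist x A ≤ (((k + 1 : ℕ) * h : ℝ≥0) : ℝ≥0∞)} := by
      intro x hx
      refine ENNReal.le_of_forall_pos_le_add fun ε hε _ => ?_
      have hlt : Metric.infEDist x B < h + ε :=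
        lt_of_le_of_lt hx (ENNReal.lt_add_right ENNReal.coe_ne_top (by exact_mod_cast hε.ne'))
      obtain ⟨y, hy, hxy⟩ := Metric.infEDist_lt_iff.1 hlt
      calc Metric.infEDist x A ≤ Metric.infEDist y A + edist x y :=
            Metric.infEDist_le_infEDist_add_edist
        _ ≤ ((k * h : ℝ≥0) : ℝ≥0∞) + (h + ε) := add_le_add hy hxy.le
        _ = (((k + 1 : ℕ) * h : ℝ≥0) : ℝ≥0∞) + ε := by push_cast; ring
    have hmono := measureReal_mono (μ := μ) hsub
    have hexp : Real.exp (-((k + 1 : ℕ) : ℝ)) = Real.exp (-k) * Real.exp (-1) := by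
      rw [← Real.exp_add]
      push_cast
      ring_nf
    have he : 4 / 49 ≤ Real.exp (-1) := by
      rw [Real.exp_neg, ← one_div, le_div_iff₀ (Real.exp_pos 1)]
      linarith [Real.exp_one_lt_d9]
    rw [hexp]
    nlinarith [Real.exp_pos (-(k : ℝ))]

/-- The exponential profile for a rate `c < √λ`: with `h = 10 / c`, iterate `⌊r / h⌋` times in the
metric space `Xⁿ`. -/
lemma DimFreeConcentration.exp_of_lt_sqrtLambda {X : Type*} [MetricSpace X]
    [SecondCountableTopology X] [MeasurableSpace X] [BorelSpace X] {μ : Measure X}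
    [IsProbabilityMeasure μ] {α : ℝ≥0 → ℝ≥0} (hμ : DimFreeConcentration μ α) {c : ℝ} (hc0 : 0 < c)
    (hc : (c : EReal) < sqrtLambda α) {n : ℕ} (hn : 1 ≤ n) {A : Set (Fin n → X)}
    (hA2 : 1 / 2 ≤ (Measure.pi fun _ : Fin n => μ).real A) (r : ℝ≥0) :
    1 - 3 * Real.exp (-(1 / 10 * c * r)) ≤
      (Measure.pi fun _ : Fin n => μ).real (enlargement A r) := by
  lift c to ℝ≥0 using hc0.le
  have hc0' : c ≠ 0 := by exact_mod_cast hc0.ne'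
  set h : ℝ≥0 := 10 / c
  have hch : c * h = 10 := mul_div_cancel₀ _ hc0'
  have hh : 0 < h := by positivity
  have hν := (hμ.of_lt_sqrtLambda hc hch).power hn
  have : IsProbabilityMeasure ((Measure.pi fun _ : Fin n => μ).map (WithLp.toLp 2)) :=
    Measure.isProbabilityMeasure_map (by fun_prop)
  set k := ⌊r / h⌋₊
  have hk := one_sub_exp_le_measureReal hν (A := WithLp.toLp 2 '' A)
    (by rw [measureReal_map_toLp]; exact hA2.trans (measureReal_mono (subset_preimage_image _ _))) k
  rw [measureReal_map_toLp] at hk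
  have hkh : (k : ℝ≥0) * h ≤ r := by
    rw [← le_div_iff₀ hh]
    exact Nat.floor_le zero_le
  have hmono : (Measure.pi fun _ : Fin n => μ).real (WithLp.toLp 2 ⁻¹'
      {y : PiLp 2 (fun _ : Fin n => X) |
        Metric.infEDist y (WithLp.toLp 2 '' A) ≤ ((k * h : ℝ≥0) : ℝ≥0∞)}) ≤
      (Measure.pi fun _ : Fin n => μ).real (enlargement A r) :=
    measureReal_mono fun x hx => le_trans hx (ENNReal.coe_le_coe.2 hkh)
  refine le_trans ?_ (hk.trans hmono)
  have hfl : (1 / 10 * c * r : ℝ) ≤ k + 1 := by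
    have h1 : r / h < k + 1 := Nat.lt_floor_add_one _
    have h2 : ((r / h : ℝ≥0) : ℝ) < k + 1 := by exact_mod_cast h1
    refine le_trans (le_of_eq ?_) h2.le
    simp only [h]
    push_cast
    field_simp
  have hexp : Real.exp (-k) ≤ Real.exp 1 * Real.exp (-(1 / 10 * c * r)) := by
    rw [← Real.exp_add]
    gcongr
    linarith
  nlinarith [Real.exp_one_lt_d9, Real.exp_pos (-(1 / 10 * c * r : ℝ))]

/-! ### The exponential profile with rate `√λ` -/

lemma sqrtLambda_pos {α : ℝ≥0 → ℝ≥0} (hα : Antitone α) (h : ∃ r₀ : ℝ≥0, (α r₀ : ℝ) < 1 / 2) :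
    0 < sqrtLambda α := by
  obtain ⟨r₀, h₀⟩ := h
  -- The supremum runs over positive `r` only, so that `r₀` is moved away from `0`.
  have h1 : (α (r₀ + 1) : ℝ) < 1 / 2 := lt_of_le_of_lt (by exact_mod_cast hα le_self_add) h₀
  obtain ⟨x, hx0, hx⟩ := exists_pos_le_gaussianTail h1
  have hr : (0 : EReal) < ((r₀ + 1 : ℝ≥0) : ℝ) := by
    exact_mod_cast add_pos_of_nonneg_of_pos r₀.2 one_pos
  refine lt_of_lt_of_le ?_ (le_sSup ⟨r₀ + 1, by positivity, h1, rfl⟩)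
  rw [EReal.lt_div_iff hr (EReal.coe_ne_top _), zero_mul]
  exact lt_of_lt_of_le (EReal.coe_pos.2 hx0) (le_sSup ⟨x, hx, rfl⟩)

lemma DimFreeConcentration.expProfile_sqrtLambda {X : Type*} [MetricSpace X]
    [SecondCountableTopology X] [MeasurableSpace X] [BorelSpace X] {μ : Measure X}
    [IsProbabilityMeasure μ] {α : ℝ≥0 → ℝ≥0} (hμ : DimFreeConcentration μ α)
    (hpos : 0 < sqrtLambda α) :
    DimFreeConcentration μ (expProfile (1 / 10) 3 (sqrtLambda α)) := by
  intro n hn A _ hA2 r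
  -- Both `√λ < ∞` and `√λ = ∞` follow by letting `c` increase to `√λ`.
  have hkey : ∀ c : ℝ, 0 < c → (c : EReal) < sqrtLambda α → _ := fun c hc0 hc =>
    hμ.exp_of_lt_sqrtLambda hc0 hc hn hA2 r
  generalize sqrtLambda α = s at hkey hpos
  induction s with
  | bot => simp at hpos
  | coe s =>
    have hs : 0 < s := by exact_mod_cast hpos
    have hprof : (expProfile (1 / 10) 3 (s : EReal) r : ℝ) = 3 * Real.exp (-(1 / 10 * s * r)) := by
      rw [expProfile, ← EReal.coe_mul, ← EReal.coe_mul, ← EReal.coe_neg, EReal.exp_coe]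
      rw [NNReal.coe_mul, ENNReal.coe_toNNReal_eq_toReal, ENNReal.toReal_ofReal (Real.exp_nonneg _)]
      norm_num
    rw [hprof]
    have hlim : Tendsto (fun c : ℝ => 1 - 3 * Real.exp (-(1 / 10 * c * r))) (𝓝[<] s)
        (𝓝 (1 - 3 * Real.exp (-(1 / 10 * s * r)))) :=
      (Continuous.tendsto (by fun_prop) s).mono_left nhdsWithin_le_nhds
    refine le_of_tendsto hlim ?_
    filter_upwards [self_mem_nhdsWithin, mem_nhdsWithin_of_mem_nhds (lt_mem_nhds hs)] with c h1 h2
    exact hkey c h2 (by exact_mod_cast h1)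
  | top =>
    rcases eq_or_ne r 0 with rfl | hr
    · -- The exponent is `∞ * 0 = 0`, and `1 - 3 < 0`.
      have : (expProfile (1 / 10) 3 ⊤ 0 : ℝ) = 3 := by simp [expProfile]
      rw [this]
      linarith [measureReal_nonneg (μ := Measure.pi fun _ : Fin n => μ) (s := enlargement A 0)]
    · have hr' : (0 : ℝ) < r := by positivity
      have : (expProfile (1 / 10) 3 ⊤ r : ℝ) = 0 := by
        have h1 : (((1 / 10 : ℝ≥0) : ℝ) : EReal) * ⊤ = ⊤ := EReal.coe_mul_top_of_pos (by norm_num)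
        rw [expProfile, h1, EReal.top_mul_coe_of_pos hr']
        simp
      rw [this, sub_zero]
      have hlim : Tendsto (fun c : ℝ => 1 - 3 * Real.exp (-(1 / 10 * c * r))) atTop (𝓝 1) := by
        have h1 : Tendsto (fun c : ℝ => 1 / 10 * c * r) atTop atTop :=
          (tendsto_id.const_mul_atTop (by norm_num)).atTop_mul_const hr'
        simpa using ((Real.tendsto_exp_neg_atTop_nhds_zero.comp h1).const_mul 3).const_sub 1
      refine le_of_tendsto hlim ?_
      filter_upwards [eventually_gt_atTop 0] with c hc
      exact hkey c hc (EReal.coe_lt_top c)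

end DimFreeConc

open DimFreeConc in
theorem corollary4p1 :
    ∃ a b : ℝ≥0, 0 < a ∧ 0 < b ∧
      ∀ (X : Type*) [MetricSpace X] [CompleteSpace X] [TopologicalSpace.SeparableSpace X]
        [MeasurableSpace X] [BorelSpace X] (μ : Measure X) [IsProbabilityMeasure μ]
        (α : ℝ≥0 → ℝ≥0), Antitone α → DimFreeConcentration μ α →
        (∃ r₀ : ℝ≥0, (α r₀ : ℝ) < 1 / 2) →
        0 < sqrtLambda α ∧ DimFreeConcentration μ (expProfile a b (sqrtLambda α)) := by
  refine ⟨1 / 10, 3, by norm_num, by norm_num, ?_⟩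
  intro X _ _ _ _ _ μ _ α hα hμ h₀
  have := UniformSpace.secondCountable_of_separable X
  have hpos := sqrtLambda_pos hα h₀
  exact ⟨hpos, hμ.expProfile_sqrtLambda hpos⟩
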